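/- A convex body in $\mathbb R^d$ is a compact convex set with non-empty interior; it is symmetric if there is a point $x_0\in\mathbb R^d$ such that $y\in\Omega$ implies $2x_0-y\in\Omega$. A set $\Lambda\subset\mathbb R^d$ is a spectrum of $\Omega$ if the exponentials $e^{2\pi i x\cdot\lambda}$, $\lambda\in\Lambda$, form an orthogonal basis of $L^2(\Omega)$, that is, they are pairwise orthogonal in $L^2(\Omega)$ and their linear span is dense there. **Theorem.** (1) Let $d\ge 2$ and let $\Omega\subset\mathbb R^d$ be a symmetric convex body whose boundary $\partial\Omega$ is smooth (a $C^\infty$ embedded hypersurface). Then $\Omega$ has no spectrum. (2) Let $\Omega\subset\mathbb R^2$ be a symmetric convex body whose boundary is piecewise smooth (a simple closed curve consisting of finitely many regular arcs that are $C^\infty$ up to their end points) and has at least one point of non-vanishing Gaussian curvature (a point near which $\partial\Omega$ is a smooth regular curve, and at which the curvature of this curve is not zero). Then $\Omega$ has no spectrum. -/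

import Mathlib

open Set MeasureTheory
open scoped ContDiff

noncomputable section

/-- A convex body in `ℝ^d`: a compact convex set with non-empty interior. -/
structure IsConvexBody {d : ℕ} (Ω : Set (EuclideanSpace ℝ (Fin d))) : Prop where
  convex : Convex ℝ Ω
  isCompact : IsCompact Ω
  interior_nonempty : (interior Ω).Nonempty

/-- `Ω` is symmetric with respect to some point `x₀`. -/
def IsSymmetricBody {d : ℕ} (Ω : Set (EuclideanSpace ℝ (Fin d))) : Prop :=
  ∃ x₀ : EuclideanSpace ℝ (Fin d), ∀ y ∈ Ω, (2 : ℝ) • x₀ - y ∈ Ω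

/-- The exponential `x ↦ e^{2π i x·l}`. -/
def expWave {d : ℕ} (l x : EuclideanSpace ℝ (Fin d)) : ℂ :=
  Complex.exp (2 * (Real.pi : ℂ) * Complex.I * ((inner ℝ x l : ℝ) : ℂ))

/-- `Λ` is a spectrum of `Ω`: the exponentials `e^{2π i x·l}`, `l ∈ Λ`, are an orthogonal basis of
the Hilbert space `L²(Ω)`, that is, they belong to `L²(Ω)`, are pairwise orthogonal there, and their
linear span is dense. (`e l` is the class of the exponential; it is unique.) -/
def IsSpectrum {d : ℕ} (Ω Λ : Set (EuclideanSpace ℝ (Fin d))) : Prop :=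
  ∃ e : Λ → Lp ℂ 2 (volume.restrict Ω),
    (∀ l : Λ, e l =ᵐ[volume.restrict Ω] expWave (l : EuclideanSpace ℝ (Fin d))) ∧
    Pairwise (fun l l' : Λ => inner ℂ (e l) (e l') = 0) ∧
    (Submodule.span ℂ (range e)).topologicalClosure = ⊤

/-- `S ⊆ ℝ^d` is a smooth (`C^∞`) embedded hypersurface: near each of its points it is the zero set
of a smooth function with non-vanishing differential at that point. -/
def IsSmoothHypersurface {d : ℕ} (S : Set (EuclideanSpace ℝ (Fin d))) : Prop :=
  ∀ p ∈ S, ∃ (U : Set (EuclideanSpace ℝ (Fin d))) (ρ : EuclideanSpace ℝ (Fin d) → ℝ),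
    IsOpen U ∧ p ∈ U ∧ ContDiffOn ℝ ∞ ρ U ∧ fderiv ℝ ρ p ≠ 0 ∧ S ∩ U = {x ∈ U | ρ x = 0}

/-- `S ⊆ ℝ²` is a piecewise smooth simple closed curve: it has a parametrization
`γ : [t 0, t n] → S`, closed and injective except for the common end point, which on each interval
`[t i, t (i+1)]` of a finite subdivision is `C^∞` up to the end points with non-zero (one-sided at
the end points) velocity. -/
def IsPiecewiseSmoothClosedCurve (S : Set (EuclideanSpace ℝ (Fin 2))) : Prop :=
  ∃ (n : ℕ) (t : Fin (n + 1) → ℝ) (γ : ℝ → EuclideanSpace ℝ (Fin 2)),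
    0 < n ∧ StrictMono t ∧
    γ (t 0) = γ (t (Fin.last n)) ∧
    InjOn γ (Ico (t 0) (t (Fin.last n))) ∧
    γ '' Icc (t 0) (t (Fin.last n)) = S ∧
    ∀ i : Fin n,
      ContDiffOn ℝ ∞ γ (Icc (t i.castSucc) (t i.succ)) ∧
      ∀ s ∈ Icc (t i.castSucc) (t i.succ), derivWithin γ (Icc (t i.castSucc) (t i.succ)) s ≠ 0

/-- The signed curvature `(x' y'' - y' x'') / (x'² + y'²)^{3/2}` of a regular plane curve
`γ = (x, y)`. -/
def planeCurvature (γ : ℝ → EuclideanSpace ℝ (Fin 2)) (s : ℝ) : ℝ :=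
  (deriv γ s 0 * iteratedDeriv 2 γ s 1 - deriv γ s 1 * iteratedDeriv 2 γ s 0) / ‖deriv γ s‖ ^ 3

/-- The set `S ⊆ ℝ²` is near `p` a smooth regular curve whose curvature at `p` is not zero. (For
curves in the plane, the Gaussian curvature is the curvature of the curve.) -/
def HasNonvanishingCurvatureAt (S : Set (EuclideanSpace ℝ (Fin 2)))
    (p : EuclideanSpace ℝ (Fin 2)) : Prop :=
  ∃ (U : Set (EuclideanSpace ℝ (Fin 2))) (a b s : ℝ) (γ : ℝ → EuclideanSpace ℝ (Fin 2)),
    IsOpen U ∧ p ∈ U ∧ s ∈ Ioo a b ∧ γ s = p ∧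
    InjOn γ (Ioo a b) ∧ γ '' Ioo a b = S ∩ U ∧
    ContDiffOn ℝ ∞ γ (Ioo a b) ∧ (∀ r ∈ Ioo a b, deriv γ r ≠ 0) ∧
    planeCurvature γ s ≠ 0

end

/-!
Suppose `Λ` is a spectrum of `Ω`. Expanding the indicator functions of two balls `B(a, η)` and
`B(b, η)` contained in `Ω` in the basis of exponentials, one finds an exponential series `F` with
frequencies in `Λ` such that `F (b - a)` is the volume of `B(a, η) ∩ B(b, η)`; and `∫ |F|²` over a
translate of `Ω` does not depend on the translate, because translation only rotates the coefficients
of `F`. So the measure `|F|² dx` charges all translates of `Ω` equally, but does not charge the long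
differences of the centres of balls contained in `Ω`.

Let now `Ω = -Ω` and suppose that infinitely many boundary points of `Ω` have pairwise no common
supporting hyperplane. For two such points `p` and `q`, a point `z` of `(p + Ω) ∩ (q + Ω)` has
`z / 2` in the interior of `Ω`: a functional supporting `Ω` at `z / 2` would also support it at `p`
and at `q`. Then `z` is the difference of the interior points `z / 2` and `-z / 2`. Dilating the
points `p` and `q` slightly keeps this and makes the translates avoid `0`, so that they are disjoint
up to null sets for small `η`. But a bounded number of translates of `Ω` covers all of them, which
contradicts the equality of their masses.

Both a smooth boundary and a curved boundary arc provide infinitely many such points.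
-/

open Filter Topology Function
open scoped Pointwise BoundedContinuousFunction

section NoCommonSupport

variable {E : Type*} [NormedAddCommGroup E] [NormedSpace ℝ E] {K : Set E} {p q : E}

/-- No hyperplane supports `K` at both `p` and `q`: the normal cones of `K` at these two points meet
only in `0`. -/
def NoCommonSupport (K : Set E) (p q : E) : Prop :=
  ∀ n : E →L[ℝ] ℝ, IsMaxOn n K p → IsMaxOn n K q → n = 0

theorem NoCommonSupport.vadd (h : NoCommonSupport K p q) (x : E) :
    NoCommonSupport (x +ᵥ K) (x +ᵥ p) (x +ᵥ q) := by
  have isMaxOn_of_vadd {n : E →L[ℝ] ℝ} {r : E} (hn : IsMaxOn n (x +ᵥ K) (x +ᵥ r)) :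
      IsMaxOn n K r := fun y hy => by
    simpa using hn (vadd_mem_vadd_set hy)
  exact fun n hp hq => h n (isMaxOn_of_vadd hp) (isMaxOn_of_vadd hq)

theorem mem_frontier_of_isMaxOn {n : E →L[ℝ] ℝ} (hn : n ≠ 0) (hp : p ∈ K)
    (hmax : IsMaxOn n K p) : p ∈ frontier K :=
  ⟨subset_closure hp, fun hint =>
    hn ((hmax.isLocalMax (mem_interior_iff_mem_nhds.1 hint)).hasFDerivAt_eq_zero n.hasFDerivAt)⟩

theorem inv_two_smul_mem_interior_of_noCommonSupport (hK : Convex ℝ K)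
    (hint : (interior K).Nonempty) (hpq : NoCommonSupport K p q) {z : E} (hzp : z ∈ p +ᵥ K)
    (hzq : z ∈ q +ᵥ K) : (2⁻¹ : ℝ) • z ∈ interior K := by
  by_contra hz
  obtain ⟨n, hn, hmax⟩ := geometric_hahn_banach_of_nonempty_interior_point hK hz hint
  -- the maximum of `n` over `K` is attained at the midpoint `z / 2`, hence at both ends
  have isMaxOn_of_mem {r : E} (hr : z ∈ r +ᵥ K) : IsMaxOn n K r := fun x hx => by
    obtain ⟨u, hu, rfl⟩ := hr
    have hxz := hmax x hx
    have huz := hmax u hu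
    simp only [vadd_eq_add, map_smul, map_add, smul_eq_mul, mem_ofPred_eq] at hxz huz ⊢
    linarith
  exact hn (hpq n (isMaxOn_of_mem hzp) (isMaxOn_of_mem hzq))

theorem eventually_inv_two_smul_mem_interior (hK : Convex ℝ K) (hcomp : IsCompact K)
    (hint : (interior K).Nonempty) (hpq : NoCommonSupport K p q) :
    ∀ᶠ t : ℝ in 𝓝 1, ∀ z ∈ (t • p +ᵥ K) ∩ (t • q +ᵥ K), (2⁻¹ : ℝ) • z ∈ interior K := by
  have h : ∀ᶠ t : ℝ in 𝓝 1, ∀ u ∈ K,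
      -(t • q) + (t • p + u) ∈ K → (2⁻¹ : ℝ) • (t • p + u) ∈ interior K := by
    refine hcomp.eventually_forall_of_forall_eventually fun u hu => ?_
    by_cases hv : -q + (p + u) ∈ K
    · have hmem : (2⁻¹ : ℝ) • (p + u) ∈ interior K :=
        inv_two_smul_mem_interior_of_noCommonSupport hK hint hpq (vadd_mem_vadd_set hu)
          (mem_vadd_set_iff_neg_vadd_mem.2 hv)
      have hcont : ContinuousAt (fun x : ℝ × E => (2⁻¹ : ℝ) • (x.1 • p + x.2)) (1, u) := by fun_prop
      filter_upwards [hcont.eventually_mem (isOpen_interior.mem_nhds (by simpa using hmem))]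
        with x hx _ using hx
    · have hcont : ContinuousAt (fun x : ℝ × E => -(x.1 • q) + (x.1 • p + x.2)) (1, u) := by
        fun_prop
      have hcompl : Kᶜ ∈ 𝓝 (-((1 : ℝ) • q) + ((1 : ℝ) • p + u)) :=
        hcomp.isClosed.isOpen_compl.mem_nhds (by simpa using hv)
      filter_upwards [hcont.eventually_mem hcompl] with x hx hx' using absurd hx' hx
  filter_upwards [h] with t ht z ⟨hzp, hzq⟩
  obtain ⟨u, hu, rfl⟩ := hzp
  exact ht u hu (mem_vadd_set_iff_neg_vadd_mem.1 hzq)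

theorem zero_notMem_smul_vadd (hK : Convex ℝ K) (hsymm : ∀ x ∈ K, -x ∈ K)
    (h0 : (0 : E) ∈ interior K) (hp : p ∈ frontier K) {t : ℝ} (ht : 1 < t) :
    (0 : E) ∉ t • p +ᵥ K := fun h => by
  have htp : t • p ∈ K := by
    simpa using hsymm _ (mem_vadd_set_iff_neg_vadd_mem.1 h)
  have hint := hK.combo_interior_self_mem_interior h0 htp (a := 1 - t⁻¹) (b := t⁻¹)
    (sub_pos.2 (inv_lt_one_of_one_lt₀ ht)) (by positivity) (sub_add_cancel _ _)
  rw [smul_zero, zero_add, inv_smul_smul₀ (by positivity)] at hint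
  exact hp.2 hint

end NoCommonSupport

section WeakTiling

variable {E : Type*} [NormedAddCommGroup E] [MeasurableSpace E]

/-- A weak tiling of the space by `K` at scale `η`: the measure `ν` gives mass one to every
translate of `K` and does not charge the differences, of norm at least `2 η`, of the centres of two
balls of radius `η` contained in `K`. The model case is a tiling by translates `K + t`, with `ν` the
sum of the Dirac masses at the points `-t`. -/
structure IsWeakTiling (ν : Measure E) (K : Set E) (η : ℝ) : Prop where
  measure_vadd : ∀ x : E, ν (x +ᵥ K) = 1
  measure_differences :
    ν {z | 2 * η ≤ ‖z‖ ∧ ∃ a, Metric.ball a η ⊆ K ∧ Metric.ball (a + z) η ⊆ K} = 0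

variable {ν : Measure E} {K : Set E} {η : ℝ}

theorem IsWeakTiling.vadd (h : IsWeakTiling ν K η) (x : E) : IsWeakTiling ν (x +ᵥ K) η where
  measure_vadd y := by rw [vadd_vadd, h.measure_vadd]
  measure_differences := by
    refine measure_mono_null ?_ h.measure_differences
    rintro z ⟨hz, a, ha, haz⟩
    simp only [subset_vadd_set_iff, Metric.vadd_ball, vadd_eq_add] at ha haz
    exact ⟨hz, -x + a, ha, by rwa [add_assoc]⟩

theorem card_le_card_of_aedisjoint_vadd {ι : Type*} (hmeas : ∀ x : E, NullMeasurableSet (x +ᵥ K) ν)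
    (hν : ∀ x : E, ν (x +ᵥ K) = 1) {M : Finset ι} {p : ι → E}
    (hdisj : (M : Set ι).Pairwise (AEDisjoint ν on fun i => p i +ᵥ K)) {T : Finset E}
    (hT : ⋃ i ∈ M, p i +ᵥ K ⊆ ⋃ x ∈ T, (x + ·) ⁻¹' K) : M.card ≤ T.card := by
  have hcover (x : E) : ν ((x + ·) ⁻¹' K) = 1 := by
    rw [← hν (-x), ← preimage_vadd]
    rfl
  have : (M.card : ENNReal) ≤ T.card := calc
    (M.card : ENNReal) = ∑ i ∈ M, ν (p i +ᵥ K) := by simp [hν]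
    _ = ν (⋃ i ∈ M, p i +ᵥ K) := (measure_biUnion_finset₀ hdisj fun i _ => hmeas (p i)).symm
    _ ≤ ν (⋃ x ∈ T, (x + ·) ⁻¹' K) := measure_mono hT
    _ ≤ ∑ x ∈ T, ν ((x + ·) ⁻¹' K) := measure_biUnion_finset_le _ _
    _ = T.card := by simp [hcover]
  exact_mod_cast this

variable [NormedSpace ℝ E]

theorem IsWeakTiling.measure_far_of_symmetric (h : IsWeakTiling ν K η) (hsymm : ∀ x ∈ K, -x ∈ K) :
    ν {z | 2 * η ≤ ‖z‖ ∧ Metric.ball ((2⁻¹ : ℝ) • z) η ⊆ K} = 0 := by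
  refine measure_mono_null ?_ h.measure_differences
  rintro z ⟨hz, hzK⟩
  refine ⟨hz, -((2⁻¹ : ℝ) • z), ?_, ?_⟩
  · rw [← neg_ball]
    exact fun y hy => neg_neg y ▸ hsymm _ (hzK hy)
  · rwa [show -((2⁻¹ : ℝ) • z) + z = (2⁻¹ : ℝ) • z by module]

theorem eventually_aedisjoint_of_isWeakTiling (hsymm : ∀ x ∈ K, -x ∈ K) {A B : Set E}
    (hA : IsCompact A) (hB : IsCompact B) (h0 : (0 : E) ∉ A)
    (hAB : ∀ z ∈ A ∩ B, (2⁻¹ : ℝ) • z ∈ interior K) :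
    ∀ᶠ η in 𝓝[>] (0 : ℝ), ∀ ν : Measure E, IsWeakTiling ν K η → AEDisjoint ν A B := by
  obtain ⟨δ, hδ, hδA⟩ := Metric.mem_nhds_iff.1 (hA.isClosed.isOpen_compl.mem_nhds h0)
  have hcomp : IsCompact ((2⁻¹ : ℝ) • (A ∩ B)) := (hA.inter hB).smul _
  obtain ⟨ε, hε, hεK⟩ := hcomp.exists_thickening_subset_open isOpen_interior
    (image_subset_iff.2 hAB)
  filter_upwards [Ioo_mem_nhdsGT (lt_min (half_pos hδ) hε)] with η hη ν hν
  refine measure_mono_null ?_ (hν.measure_far_of_symmetric hsymm)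
  have hηδ : 2 * η ≤ δ := by linarith [hη.2.trans_le (min_le_left (δ / 2) ε)]
  refine fun z hz => ⟨?_, ?_⟩
  · by_contra! hlt
    exact hδA (mem_ball_zero_iff.2 (hlt.trans_le hηδ)) hz.1
  · calc Metric.ball ((2⁻¹ : ℝ) • z) η ⊆ Metric.ball ((2⁻¹ : ℝ) • z) ε :=
          Metric.ball_subset_ball (hη.2.le.trans (min_le_right _ _))
      _ ⊆ Metric.thickening ε ((2⁻¹ : ℝ) • (A ∩ B)) :=
          Metric.ball_subset_thickening (smul_mem_smul_set hz) ε
      _ ⊆ K := hεK.trans interior_subset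

theorem finite_of_eventually_exists_isWeakTiling [BorelSpace E] {ι : Type*} (hK : Convex ℝ K)
    (hcomp : IsCompact K) (hsymm : ∀ x ∈ K, -x ∈ K) (h0 : (0 : E) ∈ interior K)
    (hν : ∀ᶠ η in 𝓝[>] (0 : ℝ), ∃ ν : Measure E, IsWeakTiling ν K η) {P : ι → E}
    (hP : ∀ i, P i ∈ frontier K) (hsep : Pairwise (NoCommonSupport K on P)) : Finite ι := by
  have hPK (i : ι) : P i ∈ K := hcomp.isClosed.frontier_subset (hP i)
  obtain ⟨T, hT⟩ := compact_covered_by_add_left_translates ((hcomp.smul (2 : ℝ)).add hcomp) ⟨0, h0⟩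
  by_contra hι
  rw [not_finite_iff_infinite] at hι
  obtain ⟨M, hM⟩ := Infinite.exists_subset_card_eq ι (T.card + 1)
  have hmid : ∀ᶠ t in 𝓝 (1 : ℝ), ∀ i ∈ M, ∀ j ∈ M, i ≠ j →
      ∀ z ∈ (t • P i +ᵥ K) ∩ (t • P j +ᵥ K), (2⁻¹ : ℝ) • z ∈ interior K := by
    simp only [eventually_all_finset, eventually_imp_distrib_left]
    exact fun i _ j _ hij =>
      eventually_inv_two_smul_mem_interior hK hcomp ⟨0, h0⟩ (hsep hij)
  -- at `t = 1` all these translates contain `0`, where a weak tiling may have mass; dilate slightly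
  obtain ⟨t, ht, ht1, ht2⟩ :=
    ((hmid.filter_mono nhdsWithin_le_nhds).and (Ioo_mem_nhdsGT one_lt_two)).exists
  have hdisj : ∀ᶠ η in 𝓝[>] (0 : ℝ), ∀ i ∈ M, ∀ j ∈ M, i ≠ j → ∀ ν : Measure E,
      IsWeakTiling ν K η → AEDisjoint ν (t • P i +ᵥ K) (t • P j +ᵥ K) := by
    simp only [eventually_all_finset, eventually_imp_distrib_left]
    exact fun i hi j hj hij => eventually_aedisjoint_of_isWeakTiling hsymm (hcomp.vadd _)
      (hcomp.vadd _) (zero_notMem_smul_vadd hK hsymm h0 (hP i) ht1) (ht i hi j hj hij)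
  obtain ⟨η, ⟨ν, hν⟩, hη⟩ := (hν.and hdisj).exists
  have hcover : ⋃ i ∈ M, t • P i +ᵥ K ⊆ ⋃ x ∈ T, (x + ·) ⁻¹' K := by
    refine (iUnion₂_subset fun i _ => ?_).trans hT
    rintro _ ⟨u, hu, rfl⟩
    have hti : (t / 2) • P i ∈ K := hK.smul_mem_of_zero_mem (interior_subset h0) (hPK i)
      ⟨by linarith, by linarith⟩
    refine add_mem_add ⟨_, hti, ?_⟩ hu
    simp only [smul_smul, mul_div_cancel₀ t two_ne_zero]
  have hcard := card_le_card_of_aedisjoint_vadd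
    (fun x => (hcomp.isClosed.vadd x).measurableSet.nullMeasurableSet) hν.measure_vadd
    (fun i hi j hj hij => hη i hi j hj hij ν hν) hcover
  omega

end WeakTiling

section HilbertBasis

variable {ι 𝕜 H : Type*} [RCLike 𝕜] [NormedAddCommGroup H] [InnerProductSpace 𝕜 H]

theorem hasSum_norm_sq_of_hilbertBasis (b : HilbertBasis ι 𝕜 H) {c : ι → 𝕜} {x : H}
    (h : HasSum (fun i => c i • b i) x) : HasSum (fun i => ‖c i‖ ^ 2) (‖x‖ ^ 2) := by
  have hrepr (i : ι) : b.repr x i = c i := by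
    rw [b.repr_apply_apply]
    refine (h.mapL (innerSL 𝕜 (b i))).unique ?_
    convert hasSum_single i fun j hj => ?_ using 1
    · simp [b.orthonormal.1 i]
    · simp [b.orthonormal.2 hj.symm]
  simpa [hrepr] using lp.hasSum_norm (by norm_num) (b.repr x)

theorem exists_hilbertBasis_of_orthogonal [CompleteSpace H] {e : ι → H} {r : ℝ} (hr : r ≠ 0)
    (hnorm : ∀ i, ‖e i‖ = r) (horth : Pairwise fun i j => inner 𝕜 (e i) (e j) = 0)
    (hspan : (Submodule.span 𝕜 (range e)).topologicalClosure = ⊤) :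
    ∃ b : HilbertBasis ι 𝕜 H, ∀ i, e i = (r : 𝕜) • b i := by
  have hr' : (r : 𝕜) ≠ 0 := RCLike.ofReal_ne_zero.2 hr
  have hon : Orthonormal 𝕜 fun i => (r : 𝕜)⁻¹ • e i := by
    refine ⟨fun i => ?_, fun i j hij => ?_⟩
    · rw [norm_smul, norm_inv, RCLike.norm_ofReal, ← hnorm i, abs_norm,
        inv_mul_cancel₀ (hnorm i ▸ hr)]
    · simp [inner_smul_left, inner_smul_right, horth hij]
  have hspan' : Submodule.span 𝕜 (range fun i => (r : 𝕜)⁻¹ • e i) = Submodule.span 𝕜 (range e) := by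
    rw [← Submodule.span_smul_eq_of_isUnit (range e) _ (IsUnit.mk0 _ (inv_ne_zero hr'))]
    congr 1
    exact range_comp ((r : 𝕜)⁻¹ • ·) e
  refine ⟨HilbertBasis.mk hon (hspan' ▸ hspan.ge), fun i => ?_⟩
  rw [HilbertBasis.coe_mk, smul_inv_smul₀ hr']

end HilbertBasis

section ExpWave

variable {d : ℕ} (l x y : EuclideanSpace ℝ (Fin d))

theorem norm_expWave : ‖expWave l x‖ = 1 := by
  rw [expWave, ← Complex.norm_exp_ofReal_mul_I (2 * Real.pi * inner ℝ x l)]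
  push_cast
  ring_nf

theorem expWave_zero : expWave l 0 = 1 := by
  simp [expWave]

theorem expWave_add : expWave l (x + y) = expWave l x * expWave l y := by
  simp only [expWave, inner_add_left, Complex.ofReal_add, mul_add, Complex.exp_add]

theorem expWave_sub : expWave l (x - y) = expWave l x * starRingEnd ℂ (expWave l y) := by
  rw [← sub_add_cancel x y, expWave_add, mul_assoc, Complex.mul_conj', norm_expWave]
  simp

theorem continuous_expWave : Continuous (expWave l) := by
  unfold expWave
  fun_prop

/-- The exponential of frequency `l` as a bounded continuous function. -/
noncomputable def boundedExpWave : EuclideanSpace ℝ (Fin d) →ᵇ ℂ :=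
  .ofNormedAddCommGroup (expWave l) (continuous_expWave l) 1 fun x => (norm_expWave l x).le

theorem norm_boundedExpWave_le : ‖boundedExpWave l‖ ≤ 1 :=
  BoundedContinuousFunction.norm_ofNormedAddCommGroup_le _ zero_le_one _

theorem setIntegral_vadd_expWave (S : Set (EuclideanSpace ℝ (Fin d))) :
    ∫ y in x +ᵥ S, expWave l y = expWave l x * ∫ y in S, expWave l y := by
  have := (measurePreserving_add_left volume x).setIntegral_image_emb
    (measurableEmbedding_addLeft x) (expWave l) S
  simp only [expWave_add, integral_const_mul] at this
  exact this

theorem norm_toLp_boundedExpWave (μ : Measure (EuclideanSpace ℝ (Fin d))) [IsFiniteMeasure μ] :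
    ‖(boundedExpWave l).toLp 2 μ ℂ‖ = √(μ.real univ) := by
  have hae : ∀ᵐ x ∂μ, ‖(boundedExpWave l).toLp 2 μ ℂ x‖ = ‖(1 : ℂ)‖ := by
    filter_upwards [(boundedExpWave l).coeFn_toLp 2 μ ℂ] with x hx
    rw [hx, norm_one]
    exact norm_expWave l x
  rw [Lp.norm_def, eLpNorm_congr_norm_ae hae]
  by_cases hμ : μ = 0
  · simp [hμ]
  rw [eLpNorm_const _ two_ne_zero hμ]
  simp [Real.sqrt_eq_rpow, Measure.real, ENNReal.toReal_rpow]

end ExpWave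

section ExpSeries

variable {d : ℕ} {Λ : Set (EuclideanSpace ℝ (Fin d))} {c : Λ → ℂ}

/-- The exponential series `∑ c l * e^{2π i x·l}`, `l ∈ Λ`, with absolutely summable coefficients,
as a bounded continuous function. (It is `0` if the series is not summable in the supremum norm.) -/
noncomputable def expSeries (c : Λ → ℂ) : EuclideanSpace ℝ (Fin d) →ᵇ ℂ :=
  ∑' l, c l • boundedExpWave (l : EuclideanSpace ℝ (Fin d))

theorem hasSum_expSeries (hc : Summable fun l => ‖c l‖) :
    HasSum (fun l => c l • boundedExpWave (l : EuclideanSpace ℝ (Fin d))) (expSeries c) := by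
  refine (hc.of_norm_bounded fun l => ?_).hasSum
  rw [norm_smul]
  exact mul_le_of_le_one_right (norm_nonneg _) (norm_boundedExpWave_le _)

theorem hasSum_expSeries_apply (hc : Summable fun l => ‖c l‖) (x : EuclideanSpace ℝ (Fin d)) :
    HasSum (fun l => c l * expWave l x) (expSeries c x) :=
  (hasSum_expSeries hc).mapL (BoundedContinuousFunction.evalCLM ℂ x)

theorem expSeries_add (hc : Summable fun l => ‖c l‖) (x y : EuclideanSpace ℝ (Fin d)) :
    expSeries c (x + y) = expSeries (fun l => c l * expWave l x) y := by
  refine (hasSum_expSeries_apply hc _).unique ?_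
  simp only [expWave_add, ← mul_assoc]
  exact hasSum_expSeries_apply (by simpa [norm_expWave] using hc) y

end ExpSeries

theorem lintegral_enorm_sq_eq_enorm_toLp_sq {α : Type*} [TopologicalSpace α] [MeasurableSpace α]
    [BorelSpace α] (μ : Measure α) [IsFiniteMeasure μ] (f : α →ᵇ ℂ) :
    ∫⁻ x, ‖f x‖ₑ ^ 2 ∂μ = ‖f.toLp 2 μ ℂ‖ₑ ^ 2 := by
  rw [Lp.enorm_def, eLpNorm_congr_ae (f.coeFn_toLp 2 μ ℂ)]
  simpa using (eLpNorm_nnreal_pow_eq_lintegral (μ := μ) (f := f) (p := 2) two_ne_zero).symm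

section Spectrum

variable {d : ℕ} {Ω Λ S : Set (EuclideanSpace ℝ (Fin d))} [IsFiniteMeasure (volume.restrict Ω)]
  {c : Λ → ℂ} {a b : EuclideanSpace ℝ (Fin d)}

theorem IsSpectrum.exists_hilbertBasis (h : IsSpectrum Ω Λ) (hΩ : volume.real Ω ≠ 0) :
    ∃ u : HilbertBasis Λ ℂ (Lp ℂ 2 (volume.restrict Ω)), ∀ l : Λ,
      (boundedExpWave (l : EuclideanSpace ℝ (Fin d))).toLp 2 (volume.restrict Ω) ℂ =
        (√(volume.real Ω) : ℂ) • u l := by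
  obtain ⟨e, he, horth, hspan⟩ := h
  have he' : e = fun l : Λ => (boundedExpWave (l : EuclideanSpace ℝ (Fin d))).toLp 2 _ ℂ :=
    funext fun l => Lp.ext ((he l).trans ((boundedExpWave _).coeFn_toLp 2 _ ℂ).symm)
  subst he'
  refine exists_hilbertBasis_of_orthogonal ?_ (fun l => ?_) horth hspan
  · exact Real.sqrt_ne_zero'.2 (measureReal_nonneg.lt_of_ne' hΩ)
  · rw [norm_toLp_boundedExpWave, measureReal_restrict_apply_univ]

theorem IsSpectrum.hasSum_norm_sq_toLp_expSeries (h : IsSpectrum Ω Λ) (hΩ : volume.real Ω ≠ 0)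
    (hc : Summable fun l => ‖c l‖) :
    HasSum (fun l => volume.real Ω * ‖c l‖ ^ 2)
      (‖(expSeries c).toLp 2 (volume.restrict Ω) ℂ‖ ^ 2) := by
  obtain ⟨u, hu⟩ := h.exists_hilbertBasis hΩ
  have hsum := (hasSum_expSeries hc).mapL (BoundedContinuousFunction.toLp 2 (volume.restrict Ω) ℂ)
  simp only [map_smul, hu, smul_smul] at hsum
  refine (hasSum_norm_sq_of_hilbertBasis u hsum).congr_fun fun l => ?_
  rw [norm_mul, mul_pow, Complex.norm_real, Real.norm_of_nonneg (Real.sqrt_nonneg _),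
    Real.sq_sqrt measureReal_nonneg, mul_comm]

theorem IsSpectrum.setLIntegral_vadd_expSeries (h : IsSpectrum Ω Λ) (hΩ : volume.real Ω ≠ 0)
    (hc : Summable fun l => ‖c l‖) (x : EuclideanSpace ℝ (Fin d)) :
    ∫⁻ y in x +ᵥ Ω, ‖expSeries c y‖ₑ ^ 2 = ∫⁻ y in Ω, ‖expSeries c y‖ₑ ^ 2 := by
  have hnorm (l : Λ) : ‖c l * expWave l x‖ = ‖c l‖ := by rw [norm_mul, norm_expWave, mul_one]
  have hcx : Summable fun l : Λ => ‖c l * expWave l x‖ := by simpa only [hnorm] using hc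
  have hsum := h.hasSum_norm_sq_toLp_expSeries hΩ hcx
  simp only [hnorm] at hsum
  have heq : ‖(expSeries fun l : Λ => c l * expWave l x).toLp 2 (volume.restrict Ω) ℂ‖ =
      ‖(expSeries c).toLp 2 (volume.restrict Ω) ℂ‖ :=
    (pow_left_inj₀ (norm_nonneg _) (norm_nonneg _) two_ne_zero).1
      (hsum.unique (h.hasSum_norm_sq_toLp_expSeries hΩ hc))
  calc ∫⁻ y in x +ᵥ Ω, ‖expSeries c y‖ₑ ^ 2
      = ∫⁻ y in Ω, ‖expSeries c (x + y)‖ₑ ^ 2 :=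
        ((measurePreserving_add_left volume x).setLIntegral_comp_emb
          (measurableEmbedding_addLeft x) (fun y => ‖expSeries c y‖ₑ ^ 2) Ω).symm
    _ = ∫⁻ y in Ω, ‖expSeries c y‖ₑ ^ 2 := by
        simp only [expSeries_add hc, lintegral_enorm_sq_eq_enorm_toLp_sq]
        rw [← ofReal_norm, heq, ofReal_norm]

/-- The squared modulus of the coefficient of the indicator function of `S ⊆ Ω` with respect to the
exponential of frequency `l`, normalized in `L²(Ω)`. It does not change when `S` is translated. -/
noncomputable def fourierWeight (Ω S : Set (EuclideanSpace ℝ (Fin d)))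
    (l : EuclideanSpace ℝ (Fin d)) : ℝ :=
  ‖∫ y in S, expWave l y‖ ^ 2 / volume.real Ω

theorem inner_indicatorConstLp_toLp_boundedExpWave (hS : MeasurableSet S) (hSΩ : S ⊆ Ω)
    (l : EuclideanSpace ℝ (Fin d)) :
    inner ℂ (indicatorConstLp 2 hS (measure_ne_top (volume.restrict Ω) S) (1 : ℂ))
      ((boundedExpWave l).toLp 2 (volume.restrict Ω) ℂ) = ∫ y in S, expWave l y := by
  rw [L2.inner_indicatorConstLp_one,
    integral_congr_ae (ae_restrict_of_ae ((boundedExpWave l).coeFn_toLp 2 _ ℂ)),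
    Measure.restrict_restrict hS, inter_eq_self_of_subset_left hSΩ]
  rfl

theorem IsSpectrum.hasSum_fourierWeight_mul_expWave (h : IsSpectrum Ω Λ) (hΩ : volume.real Ω ≠ 0)
    (hS : MeasurableSet S) (ha : a +ᵥ S ⊆ Ω) (hb : b +ᵥ S ⊆ Ω) :
    HasSum (fun l : Λ => (fourierWeight Ω S l : ℂ) * expWave l (b - a))
      (volume.real ((b +ᵥ S) ∩ (a +ᵥ S)) : ℂ) := by
  obtain ⟨u, hu⟩ := h.exists_hilbertBasis hΩ
  have hcoef {x : EuclideanSpace ℝ (Fin d)} (hx : x +ᵥ S ⊆ Ω) (l : Λ) :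
      (√(volume.real Ω) : ℂ) * inner ℂ (indicatorConstLp 2 (hS.const_vadd x)
        (measure_ne_top (volume.restrict Ω) _) (1 : ℂ)) (u l) =
      expWave l x * ∫ y in S, expWave l y := by
    rw [← inner_smul_right, ← hu, inner_indicatorConstLp_toLp_boundedExpWave _ hx,
      setIntegral_vadd_expWave]
  have hparseval := u.hasSum_inner_mul_inner
    (indicatorConstLp 2 (hS.const_vadd b) (measure_ne_top (volume.restrict Ω) _) (1 : ℂ))
    (indicatorConstLp 2 (hS.const_vadd a) (measure_ne_top (volume.restrict Ω) _) (1 : ℂ))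
  rw [L2.inner_indicatorConstLp_one_indicatorConstLp_one,
    measureReal_restrict_apply ((hS.const_vadd b).inter (hS.const_vadd a)),
    inter_eq_self_of_subset_left (inter_subset_left.trans hb)] at hparseval
  refine hparseval.congr_fun fun l => ?_
  have hsq : (√(volume.real Ω) : ℂ) * √(volume.real Ω) = volume.real Ω := by
    rw [← Complex.ofReal_mul, Real.mul_self_sqrt measureReal_nonneg]
  have hΩ' : (volume.real Ω : ℂ) ≠ 0 := Complex.ofReal_ne_zero.2 hΩ
  have hweight : (fourierWeight Ω S l : ℂ) * expWave l (b - a) * volume.real Ω =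
      (expWave l b * ∫ y in S, expWave l y) *
        starRingEnd ℂ (expWave l a * ∫ y in S, expWave l y) := by
    rw [fourierWeight, expWave_sub, map_mul, Complex.ofReal_div, Complex.ofReal_pow,
      ← Complex.mul_conj']
    field_simp
  rw [← hcoef hb, ← hcoef ha, map_mul, Complex.conj_ofReal, inner_conj_symm,
    mul_mul_mul_comm, hsq, mul_comm] at hweight
  exact mul_left_cancel₀ hΩ' hweight

theorem IsSpectrum.summable_norm_fourierWeight (h : IsSpectrum Ω Λ) (hΩ : volume.real Ω ≠ 0)
    (hS : MeasurableSet S) (ha : a +ᵥ S ⊆ Ω) :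
    Summable fun l : Λ => ‖(fourierWeight Ω S l : ℂ)‖ := by
  simpa [expWave_zero] using (h.hasSum_fourierWeight_mul_expWave hΩ hS ha ha).summable.norm

theorem IsSpectrum.expSeries_fourierWeight (h : IsSpectrum Ω Λ) (hΩ : volume.real Ω ≠ 0)
    (hS : MeasurableSet S) (ha : a +ᵥ S ⊆ Ω) (hb : b +ᵥ S ⊆ Ω) :
    expSeries (fun l : Λ => (fourierWeight Ω S l : ℂ)) (b - a) =
      volume.real ((b +ᵥ S) ∩ (a +ᵥ S)) :=
  (hasSum_expSeries_apply (h.summable_norm_fourierWeight hΩ hS ha) _).unique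
    (h.hasSum_fourierWeight_mul_expWave hΩ hS ha hb)

theorem IsSpectrum.setLIntegral_expSeries_ne_zero (h : IsSpectrum Ω Λ) (hΩ : volume.real Ω ≠ 0)
    (hc : Summable fun l => ‖c l‖) (hne : expSeries c ≠ 0) :
    ∫⁻ y in Ω, ‖expSeries c y‖ₑ ^ 2 ≠ 0 := by
  contrapose! hne
  rw [lintegral_enorm_sq_eq_enorm_toLp_sq, sq_eq_zero_iff, enorm_eq_zero] at hne
  have hsum := h.hasSum_norm_sq_toLp_expSeries hΩ hc
  rw [hne, norm_zero, zero_pow two_ne_zero,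
    hasSum_zero_iff_of_nonneg fun l => mul_nonneg measureReal_nonneg (sq_nonneg _)] at hsum
  have hc0 (l : Λ) : c l = 0 := by simpa [hΩ] using congrFun hsum l
  simp [expSeries, hc0]

theorem IsSpectrum.exists_isWeakTiling_of_expSeries (h : IsSpectrum Ω Λ) (hΩ : volume.real Ω ≠ 0)
    (hc : Summable fun l => ‖c l‖) (hne : expSeries c ≠ 0) {η : ℝ}
    (hzero : ∀ x y, Metric.ball x η ⊆ Ω → Metric.ball y η ⊆ Ω → 2 * η ≤ ‖y - x‖ →
      expSeries c (y - x) = 0) :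
    ∃ ν : Measure (EuclideanSpace ℝ (Fin d)), IsWeakTiling ν Ω η := by
  have hmeas : Measurable fun y => ‖expSeries c y‖ₑ ^ 2 := by fun_prop
  have htop : ∫⁻ y in Ω, ‖expSeries c y‖ₑ ^ 2 ≠ ⊤ := by
    simp [lintegral_enorm_sq_eq_enorm_toLp_sq]
  refine ⟨(∫⁻ y in Ω, ‖expSeries c y‖ₑ ^ 2)⁻¹ • volume.withDensity fun y => ‖expSeries c y‖ₑ ^ 2,
    fun x => ?_, ?_⟩
  · rw [Measure.smul_apply, withDensity_apply', h.setLIntegral_vadd_expSeries hΩ hc, smul_eq_mul,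
      ENNReal.inv_mul_cancel (h.setLIntegral_expSeries_ne_zero hΩ hc hne) htop]
  · rw [Measure.smul_apply, (withDensity_apply_eq_zero hmeas).2, smul_zero]
    convert measure_empty (μ := volume)
    refine eq_empty_of_forall_notMem ?_
    rintro z ⟨hz, hnorm, x, hx, hxz⟩
    have hFz := hzero x (x + z) hx hxz (by rwa [add_sub_cancel_left])
    rw [add_sub_cancel_left] at hFz
    simp [hFz] at hz

theorem IsSpectrum.exists_isWeakTiling (h : IsSpectrum Ω Λ) {η : ℝ} (hη : 0 < η)
    (ha : Metric.ball a η ⊆ Ω) : ∃ ν : Measure (EuclideanSpace ℝ (Fin d)), IsWeakTiling ν Ω η := by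
  have vadd_ball_zero (x : EuclideanSpace ℝ (Fin d)) :
      x +ᵥ Metric.ball (0 : EuclideanSpace ℝ (Fin d)) η = Metric.ball x η := by
    rw [Metric.vadd_ball, vadd_eq_add, add_zero]
  have hball : 0 < volume.real (Metric.ball a η) :=
    ENNReal.toReal_pos (Metric.measure_ball_pos volume a hη).ne' measure_ball_lt_top.ne
  have hΩtop : volume Ω ≠ ⊤ := by simpa using measure_ne_top (volume.restrict Ω) univ
  have hΩ : volume.real Ω ≠ 0 := (hball.trans_le (measureReal_mono ha hΩtop)).ne'
  -- this exponential series is the autocorrelation of the indicator function of a ball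
  have happly {x y : EuclideanSpace ℝ (Fin d)} (hx : Metric.ball x η ⊆ Ω)
      (hy : Metric.ball y η ⊆ Ω) :
      expSeries (fun l : Λ => (fourierWeight Ω (Metric.ball 0 η) l : ℂ)) (y - x) =
        volume.real (Metric.ball y η ∩ Metric.ball x η) := by
    simpa only [vadd_ball_zero] using h.expSeries_fourierWeight hΩ measurableSet_ball
      ((vadd_ball_zero x).trans_subset hx) ((vadd_ball_zero y).trans_subset hy)
  refine h.exists_isWeakTiling_of_expSeries hΩ (h.summable_norm_fourierWeight hΩ measurableSet_ball
    ((vadd_ball_zero a).trans_subset ha)) (fun h0 => ?_) fun x y hx hy hxy => ?_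
  · have := happly ha ha
    rw [h0, inter_self, BoundedContinuousFunction.coe_zero, Pi.zero_apply] at this
    exact hball.ne (by exact_mod_cast this)
  · have hdisj : Disjoint (Metric.ball y η) (Metric.ball x η) :=
      Metric.ball_disjoint_ball (by rwa [← two_mul, dist_eq_norm])
    rw [happly hx hy, hdisj.inter_eq, measureReal_empty, Complex.ofReal_zero]

theorem IsSpectrum.eventually_exists_isWeakTiling (h : IsSpectrum Ω Λ)
    (hint : (interior Ω).Nonempty) :
    ∀ᶠ η in 𝓝[>] (0 : ℝ), ∃ ν : Measure (EuclideanSpace ℝ (Fin d)), IsWeakTiling ν Ω η := by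
  obtain ⟨a, ha⟩ := hint
  obtain ⟨ε, hε, hεΩ⟩ := Metric.mem_nhds_iff.1 (mem_interior_iff_mem_nhds.1 ha)
  filter_upwards [Ioo_mem_nhdsGT hε] with η hη
  exact h.exists_isWeakTiling hη.1 ((Metric.ball_subset_ball hη.2.le).trans hεΩ)

end Spectrum

section SmoothPoint

variable {E : Type*} [NormedAddCommGroup E] [NormedSpace ℝ E] {K : Set E} {p q : E}

/-- The point `p` is a smooth point of `K`: the functionals supporting `K` at `p`, that is, the
normal vectors of `K` at `p`, lie on one line. -/
def IsSmoothPoint (K : Set E) (p : E) : Prop :=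
  ∃ f : E →L[ℝ] ℝ, ∀ n : E →L[ℝ] ℝ, IsMaxOn n K p → ∃ c : ℝ, n = c • f

theorem IsSmoothPoint.exists_eq_smul (h : IsSmoothPoint K p) {m n : E →L[ℝ] ℝ}
    (hm : IsMaxOn m K p) (hn : IsMaxOn n K p) (hn0 : n ≠ 0) : ∃ a : ℝ, m = a • n := by
  obtain ⟨f, hf⟩ := h
  obtain ⟨b, rfl⟩ := hf m hm
  obtain ⟨c, rfl⟩ := hf n hn
  exact ⟨b / c, by rw [smul_smul, div_mul_cancel₀ b (left_ne_zero_of_smul hn0)]⟩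

theorem IsSmoothPoint.noCommonSupport (hp : IsSmoothPoint K p) (hq : IsSmoothPoint K q)
    {m n : E →L[ℝ] ℝ} (hm : IsMaxOn m K p) (hn : IsMaxOn n K q)
    (hmn : LinearIndependent ℝ ![m, n]) : NoCommonSupport K p q := by
  intro f hfp hfq
  by_contra hf
  obtain ⟨a, rfl⟩ := hp.exists_eq_smul hm hfp hf
  obtain ⟨b, rfl⟩ := hq.exists_eq_smul hn hfq hf
  obtain ⟨hb, -⟩ := LinearIndependent.pair_iff.1 hmn b (-a) (by module)
  exact hmn.ne_zero 1 (by simp [hb])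

theorem exists_seq_noCommonSupport_of_isSmoothPoint (hcomp : IsCompact K) (hne : K.Nonempty)
    (hK : ∀ p ∈ frontier K, IsSmoothPoint K p) {f g : E →L[ℝ] ℝ}
    (hfg : LinearIndependent ℝ ![f, g]) :
    ∃ P : ℕ → E, (∀ k, P k ∈ frontier K) ∧ Pairwise (NoCommonSupport K on P) := by
  let n (k : ℕ) : E →L[ℝ] ℝ := (1 : ℝ) • f + (k : ℝ) • g
  have hn {k l : ℕ} (hkl : k ≠ l) : LinearIndependent ℝ ![n k, n l] :=
    (LinearIndependent.pair_add_smul_add_smul_iff _ _ _ _).2 ⟨hfg, by simpa using hkl.symm⟩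
  choose P hPK hPmax using fun k => hcomp.exists_isMaxOn hne (n k).continuous.continuousOn
  have hP (k : ℕ) : P k ∈ frontier K :=
    mem_frontier_of_isMaxOn ((hn k.succ_ne_self.symm).ne_zero 0) (hPK k) (hPmax k)
  exact ⟨P, hP, fun k l hkl =>
    (hK _ (hP k)).noCommonSupport (hK _ (hP l)) (hPmax k) (hPmax l) (hn hkl)⟩

end SmoothPoint

section SmoothHypersurface

variable {d : ℕ} {Ω : Set (EuclideanSpace ℝ (Fin d))}

theorem isSmoothPoint_of_isSmoothHypersurface (hΩ : IsClosed Ω)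
    (hs : IsSmoothHypersurface (frontier Ω)) {p : EuclideanSpace ℝ (Fin d)}
    (hp : p ∈ frontier Ω) : IsSmoothPoint Ω p := by
  obtain ⟨U, ρ, hU, hpU, hρ, hρ', hUS⟩ := hs p hp
  refine ⟨fderiv ℝ ρ p, fun n hn => ?_⟩
  have hρp : ρ p = 0 := (hUS.subset ⟨hp, hpU⟩).2
  have hmax : IsLocalMaxOn n {x | ρ x = ρ p} p := by
    filter_upwards [self_mem_nhdsWithin, nhdsWithin_le_nhds (hU.mem_nhds hpU)] with x hx hxU
    exact hn (hΩ.frontier_subset (hUS.superset ⟨hxU, hx.trans hρp⟩).1)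
  have hstrict : HasStrictFDerivAt ρ (fderiv ℝ ρ p) p :=
    (hρ.contDiffAt (hU.mem_nhds hpU)).hasStrictFDerivAt (by simp)
  obtain ⟨a, b, hab, h⟩ := IsLocalExtrOn.exists_multipliers_of_hasStrictFDerivAt_1d
    (Or.inr hmax) hstrict n.hasStrictFDerivAt
  have hb : b ≠ 0 := by
    rintro rfl
    rw [zero_smul, add_zero, smul_eq_zero, or_iff_left hρ'] at h
    exact hab (by rw [h, Prod.mk_zero_zero])
  refine ⟨-(b⁻¹ * a), ?_⟩
  rw [← inv_smul_smul₀ hb n, eq_neg_of_add_eq_zero_right h]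
  module

theorem linearIndependent_proj_pair {i j : Fin d} (hij : i ≠ j) :
    LinearIndependent ℝ ![(EuclideanSpace.proj i : EuclideanSpace ℝ (Fin d) →L[ℝ] ℝ),
      EuclideanSpace.proj j] := by
  refine LinearIndependent.pair_iff.2 fun a b h => ?_
  have hi := DFunLike.congr_fun h (EuclideanSpace.single i 1)
  have hj := DFunLike.congr_fun h (EuclideanSpace.single j 1)
  simpa [hij, hij.symm] using And.intro hi hj

theorem exists_seq_noCommonSupport_of_isSmoothHypersurface (hd : 2 ≤ d) (hcomp : IsCompact Ω)
    (hne : Ω.Nonempty) (hs : IsSmoothHypersurface (frontier Ω)) :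
    ∃ P : ℕ → EuclideanSpace ℝ (Fin d),
      (∀ k, P k ∈ frontier Ω) ∧ Pairwise (NoCommonSupport Ω on P) :=
  exists_seq_noCommonSupport_of_isSmoothPoint hcomp hne
    (fun _ => isSmoothPoint_of_isSmoothHypersurface hcomp.isClosed hs)
    (linearIndependent_proj_pair (i := ⟨0, by omega⟩) (j := ⟨1, by omega⟩) (by simp))

end SmoothHypersurface

section PlaneCurve

theorem apply_deriv_eq_zero_of_isMaxOn {E : Type*} [NormedAddCommGroup E] [NormedSpace ℝ E]
    {K : Set E} {γ : ℝ → E} {r : ℝ} (hγ : DifferentiableAt ℝ γ r) (hK : ∀ᶠ t in 𝓝 r, γ t ∈ K)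
    {n : E →L[ℝ] ℝ} (hn : IsMaxOn n K (γ r)) : n (deriv γ r) = 0 := by
  have hloc : IsLocalMax (n ∘ γ) r := hK.mono fun t ht => hn ht
  exact hloc.hasDerivAt_eq_zero (n.hasFDerivAt.comp_hasDerivAt r hγ.hasDerivAt)

theorem eventually_apply_ne_zero_of_hasDerivAt {E : Type*} [NormedAddCommGroup E]
    [NormedSpace ℝ E] {f : ℝ → E} {f' : E} {s : ℝ} (hf : HasDerivAt f f' s) {n : E →L[ℝ] ℝ}
    (hn : n (f s) ≠ 0 ∨ n f' ≠ 0) : ∀ᶠ r in 𝓝[≠] s, n (f r) ≠ 0 := by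
  rcases hn with hn | hn
  · exact nhdsWithin_le_nhds
      ((n.continuous.continuousAt.comp hf.continuousAt).eventually_ne hn)
  · exact (n.hasFDerivAt.comp_hasDerivAt s hf).eventually_ne hn

/-- The functional `w ↦ v × w = v₀ w₁ - v₁ w₀` on the plane, which vanishes exactly on the multiples
of `v` if `v ≠ 0`. -/
noncomputable def planeCross (v : EuclideanSpace ℝ (Fin 2)) : EuclideanSpace ℝ (Fin 2) →L[ℝ] ℝ :=
  v 0 • EuclideanSpace.proj 1 - v 1 • EuclideanSpace.proj 0

theorem planeCross_apply (v w : EuclideanSpace ℝ (Fin 2)) :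
    planeCross v w = v 0 * w 1 - v 1 * w 0 := rfl

theorem planeCross_ne_zero {v : EuclideanSpace ℝ (Fin 2)} (hv : v ≠ 0) : planeCross v ≠ 0 := by
  contrapose! hv
  ext i
  have h0 := DFunLike.congr_fun hv (EuclideanSpace.single 0 1)
  have h1 := DFunLike.congr_fun hv (EuclideanSpace.single 1 1)
  simp only [planeCross_apply] at h0 h1
  fin_cases i <;> simp_all

theorem eq_zero_of_planeCross_ne_zero {u v : EuclideanSpace ℝ (Fin 2)} (huv : planeCross u v ≠ 0)
    {n : EuclideanSpace ℝ (Fin 2) →L[ℝ] ℝ} (hu : n u = 0) (hv : n v = 0) : n = 0 := by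
  ext x
  have hcramer : planeCross u v • x = planeCross x v • u + planeCross u x • v := by
    ext i
    fin_cases i <;> simp [planeCross_apply] <;> ring
  have : planeCross u v * n x = 0 := by
    rw [← smul_eq_mul, ← map_smul, hcramer, map_add, map_smul, map_smul, hu, hv]
    simp
  simpa [huv] using this

variable {γ : ℝ → EuclideanSpace ℝ (Fin 2)} {s : ℝ}

theorem eventually_planeCross_deriv_ne_zero (hγ : DifferentiableAt ℝ (deriv γ) s)
    (hcurv : planeCurvature γ s ≠ 0) {v : EuclideanSpace ℝ (Fin 2)} (hv : v ≠ 0) :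
    ∀ᶠ r in 𝓝[≠] s, planeCross v (deriv γ r) ≠ 0 := by
  have hcross : planeCross (deriv γ s) (deriv (deriv γ) s) ≠ 0 := by
    rw [planeCurvature, iteratedDeriv_succ, iteratedDeriv_one] at hcurv
    exact fun h => hcurv (by rw [← planeCross_apply, h, zero_div])
  refine eventually_apply_ne_zero_of_hasDerivAt hγ.hasDerivAt ?_
  by_contra! h
  exact planeCross_ne_zero hv (eq_zero_of_planeCross_ne_zero hcross h.1 h.2)

theorem exists_seq_noCommonSupport_of_hasNonvanishingCurvatureAt
    {Ω : Set (EuclideanSpace ℝ (Fin 2))} (hΩ : IsClosed Ω) {p : EuclideanSpace ℝ (Fin 2)}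
    (hp : HasNonvanishingCurvatureAt (frontier Ω) p) :
    ∃ P : ℕ → EuclideanSpace ℝ (Fin 2),
      (∀ k, P k ∈ frontier Ω) ∧ Pairwise (NoCommonSupport Ω on P) := by
  obtain ⟨U, a, b, s, γ, -, -, hs, -, -, himg, hγ, hreg, hcurv⟩ := hp
  have hfrontier {r : ℝ} (hr : r ∈ Ioo a b) : γ r ∈ frontier Ω :=
    (himg.subset (mem_image_of_mem γ hr)).1
  have hkill {r : ℝ} (hr : r ∈ Ioo a b) {n : EuclideanSpace ℝ (Fin 2) →L[ℝ] ℝ}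
      (hn : IsMaxOn n Ω (γ r)) : n (deriv γ r) = 0 := by
    have hmem : Ioo a b ∈ 𝓝 r := isOpen_Ioo.mem_nhds hr
    refine apply_deriv_eq_zero_of_isMaxOn ((hγ.contDiffAt hmem).differentiableAt (by simp)) ?_ hn
    filter_upwards [hmem] with t ht using hΩ.frontier_subset (hfrontier ht)
  have hγ' : DifferentiableAt ℝ (deriv γ) s :=
    ((hγ.deriv_of_isOpen isOpen_Ioo (m := ∞) (by simp)).contDiffAt
      (isOpen_Ioo.mem_nhds hs)).differentiableAt (by simp)
  let crossing : ℝ → ℝ → Prop := NoCommonSupport Ω on γ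
  have : Std.Symm crossing := ⟨fun _ _ h n hp hq => h n hq hp⟩
  obtain ⟨r, hr, hsep⟩ := exists_seq_of_forall_finset_exists' (· ∈ Ioo a b) crossing fun M hM => by
    have hcross : ∀ᶠ r in 𝓝[≠] s, ∀ t ∈ M, planeCross (deriv γ t) (deriv γ r) ≠ 0 :=
      (eventually_all_finset M).2 fun t ht =>
        eventually_planeCross_deriv_ne_zero hγ' hcurv (hreg t (hM t ht))
    obtain ⟨r, hr, hcross⟩ :=
      ((eventually_nhdsWithin_of_eventually_nhds (isOpen_Ioo.eventually_mem hs)).and hcross).exists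
    exact ⟨r, hr, fun t ht n hnt hnr =>
      eq_zero_of_planeCross_ne_zero (hcross t ht) (hkill (hM t ht) hnt) (hkill hr hnr)⟩
  exact ⟨γ ∘ r, fun k => hfrontier (hr k), hsep⟩

end PlaneCurve

theorem zero_mem_interior_of_symmetric {E : Type*} [NormedAddCommGroup E] [NormedSpace ℝ E]
    {K : Set E} (hK : Convex ℝ K) (hint : (interior K).Nonempty) (hsymm : ∀ x ∈ K, -x ∈ K) :
    (0 : E) ∈ interior K := by
  obtain ⟨x, hx⟩ := hint
  simpa using hK.combo_interior_self_mem_interior hx (hsymm x (interior_subset hx))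
    (a := 2⁻¹) (b := 2⁻¹) (by norm_num) (by norm_num) (by norm_num)

theorem theorem0p1_general {d : ℕ} {Ω : Set (EuclideanSpace ℝ (Fin d))} (hΩ : IsConvexBody Ω)
    (hsymm : IsSymmetricBody Ω)
    (hsep : ∃ P : ℕ → EuclideanSpace ℝ (Fin d),
      (∀ k, P k ∈ frontier Ω) ∧ Pairwise (NoCommonSupport Ω on P)) :
    ¬ ∃ Λ : Set (EuclideanSpace ℝ (Fin d)), IsSpectrum Ω Λ := by
  rintro ⟨Λ, hΛ⟩
  obtain ⟨x₀, hx₀⟩ := hsymm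
  obtain ⟨P, hP, hsep⟩ := hsep
  have : IsFiniteMeasure (volume.restrict Ω) :=
    isFiniteMeasure_restrict.2 hΩ.isCompact.measure_lt_top.ne
  have hconv : Convex ℝ (-x₀ +ᵥ Ω) := hΩ.convex.vadd _
  have hcenter : ∀ x ∈ -x₀ +ᵥ Ω, -x ∈ -x₀ +ᵥ Ω := fun x hx => by
    rw [mem_vadd_set_iff_neg_vadd_mem, neg_neg, vadd_eq_add] at hx ⊢
    convert hx₀ _ hx using 1
    module
  have hint : (interior (-x₀ +ᵥ Ω)).Nonempty := by
    rw [interior_vadd]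
    exact hΩ.interior_nonempty.vadd_set
  have hfrontier (k : ℕ) : -x₀ +ᵥ P k ∈ frontier (-x₀ +ᵥ Ω) :=
    (Homeomorph.vadd (-x₀)).image_frontier Ω ▸ mem_image_of_mem _ (hP k)
  have hfinite : Finite ℕ := finite_of_eventually_exists_isWeakTiling hconv
    (hΩ.isCompact.vadd _) hcenter (zero_mem_interior_of_symmetric hconv hint hcenter)
    ((hΛ.eventually_exists_isWeakTiling hΩ.interior_nonempty).mono
      fun η ⟨ν, hν⟩ => ⟨ν, hν.vadd _⟩) hfrontier fun k l hkl => (hsep hkl).vadd _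
  exact not_finite ℕ

theorem theorem0p1 :
    (∀ (d : ℕ) (Ω : Set (EuclideanSpace ℝ (Fin d))), 2 ≤ d →
      IsConvexBody Ω → IsSymmetricBody Ω →
      IsSmoothHypersurface (frontier Ω) →
      ¬ ∃ Λ : Set (EuclideanSpace ℝ (Fin d)), IsSpectrum Ω Λ) ∧
    (∀ Ω : Set (EuclideanSpace ℝ (Fin 2)),
      IsConvexBody Ω → IsSymmetricBody Ω →
      IsPiecewiseSmoothClosedCurve (frontier Ω) →
      (∃ p ∈ frontier Ω, HasNonvanishingCurvatureAt (frontier Ω) p) →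
      ¬ ∃ Λ : Set (EuclideanSpace ℝ (Fin 2)), IsSpectrum Ω Λ) :=
  ⟨fun _ _ hd hΩ hsymm hs => theorem0p1_general hΩ hsymm
      (exists_seq_noCommonSupport_of_isSmoothHypersurface hd hΩ.isCompact
        (hΩ.interior_nonempty.mono interior_subset) hs),
    fun _ hΩ hsymm _ ⟨_, _, hp⟩ => theorem0p1_general hΩ hsymm
      (exists_seq_noCommonSupport_of_hasNonvanishingCurvatureAt hΩ.isCompact.isClosed hp)⟩
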